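/- Let $\kappa\in(0,2]$, $n\ge 1$, and let $\mathbf B_\kappa=(B_{1,\kappa},\dots,B_{n,\kappa})$, where $B_{i,\kappa}=\{B_{i,\kappa}(t),t\in\mathbb R\}$ are mutually independent standard fractional Brownian motions with Hurst index $\kappa/2$, i.e. centered Gaussian processes with a.s. continuous sample paths and $\mathrm{Cov}(B_{i,\kappa}(s),B_{i,\kappa}(t))=\tfrac12(|s|^\kappa+|t|^\kappa-|t-s|^\kappa)$. Let $\mathbf C=(C_1,\dots,C_n)$ with $C_i\ge 0$ for all $i$ and $\mathbf C\ne\mathbf 0$. For continuous functions $d_1,\dots,d_n:\mathbb R\to\mathbb R$ with $d_i(0)=0$, $\mathbf d=(d_1,\dots,d_n)$, and $S_1,S_2\ge 0$ with $\max(S_1,S_2)>0$, put $$\mathcal H_{\mathbf C\mathbf B_\kappa,\mathbf d}[-S_1,S_2]=\int_{\mathbb R^n}e^{\sum_{i=1}^n w_i}\,\mathbb P\Bigl(\exists\, t\in[-S_1,S_2]\ \forall\, 1\le i\le n:\ \sqrt2\,C_iB_{i,\kappa}(t)-C_i^2|t|^\kappa-d_i(t)>w_i\Bigr)\,d\mathbf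 w\in[0,\infty].$$ Define the generalized Pickands constant by $$\mathcal H_{\mathbf C\mathbf B_\kappa}=\lim_{S\to\infty}S^{-1}\mathcal H_{\mathbf C\mathbf B_\kappa,\mathbf 0}[0,S].$$ Let $\underline{\mathbf d}=(\underline d_1,\dots,\underline d_n)$, $\overline{\mathbf d}=(\overline d_1,\dots,\overline d_n)\in\mathbb R^n$ satisfy $\sum_{i=1}^n\underline d_i>0$ and $\sum_{i=1}^n\overline d_i>0$, let $d_i(t)=\underline d_i|t|^\kappa 1_{\{t\le 0\}}+\overline d_i|t|^\kappa 1_{\{t>0\}}$, and define the generalized Piterbarg constants by $$\mathcal H_{\mathbf C\mathbf B_\kappa}^{\overline{\mathbf d}}=\lim_{S\to\infty}\mathcal H_{\mathbf C\mathbf B_\kappa,\mathbf d}[0,S],\qquad \mathcal H_{\mathbf C\mathbf B_\kappa}^{\underline{\mathbf d},\overline{\mathbf d}}=\lim_{S\to\infty}\mathcal H_{\mathbf C\mathbf B_\kappa,\mathbf d}[-S,S].$$ Then these three limits exist in $[0,\infty]$, $$\mathcal H_{\mathbf C\mathbf B_\kappa}^{\overline{\mathbf d}}\ \ge\ \Bigl(e\kappa\sum_{i=1}^n\max(0,\overline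 d_i)\Bigr)^{-1/\kappa}\mathcal H_{\mathbf C\mathbf B_\kappa},$$ and $$\mathcal H_{\mathbf C\mathbf B_\kappa}^{\underline{\mathbf d},\overline{\mathbf d}}\ \ge\ 2\,(e\kappa)^{-1/\kappa}\Bigl(\sum_{i=1}^n\bigl(\max(0,\underline d_i)+\max(0,\overline d_i)\bigr)\Bigr)^{-1/\kappa}\mathcal H_{\mathbf C\mathbf B_\kappa}.$$ -/

import Mathlib

open MeasureTheory ProbabilityTheory Filter Topology
open scoped ENNReal

noncomputable section

/-- A standard fractional Brownian motion on the whole real line with Hurst index `κ / 2`,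
defined on a probability space `(Ω, P)`: a centered Gaussian process with almost surely
continuous sample paths and the covariance function
`Cov(X(s), X(t)) = (|s|^κ + |t|^κ - |t - s|^κ) / 2`. -/
structure IsStandardFBM {Ω : Type*} [MeasurableSpace Ω] (P : Measure Ω) (κ : ℝ)
    (X : ℝ → Ω → ℝ) : Prop where
  measurable : ∀ t, Measurable (X t)
  gaussian : IsGaussianProcess X P
  centered : ∀ t, ∫ ω, X t ω ∂P = 0
  covariance_eq : ∀ s t, cov[X s, X t; P] = (|s| ^ κ + |t| ^ κ - |t - s| ^ κ) / 2
  continuous_paths : ∀ᵐ ω ∂P, Continuous fun t => X t ω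

/-- A vector-valued process `(B_1, …, B_n)` on the real line whose coordinates are mutually
independent (as processes) standard fractional Brownian motions with Hurst index `κ / 2`. -/
structure IsVectorFBM {Ω : Type*} [MeasurableSpace Ω] (P : Measure Ω) {n : ℕ} (κ : ℝ)
    (B : Fin n → ℝ → Ω → ℝ) : Prop where
  isStandardFBM : ∀ i, IsStandardFBM P κ (B i)
  indep : iIndepFun (fun (i : Fin n) (ω : Ω) (t : ℝ) => B i t ω) P

/-- The quantity `H_{Y,d}[-S₁,S₂]`, namely
`∫_{ℝⁿ} exp(∑ᵢ wᵢ) P(∃ t ∈ [-S₁,S₂], ∀ i, √2 Yᵢ(t) - Var(Yᵢ(t)) - dᵢ(t) > wᵢ) dw`,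
with values in `[0, ∞]`. -/
def pickandsPiterbargH {Ω : Type*} [MeasurableSpace Ω] (P : Measure Ω) {n : ℕ}
    (Y : Fin n → ℝ → Ω → ℝ) (d : Fin n → ℝ → ℝ) (S₁ S₂ : ℝ) : ℝ≥0∞ :=
  ∫⁻ w : Fin n → ℝ, ENNReal.ofReal (Real.exp (∑ i, w i)) *
    P {ω | ∃ t ∈ Set.Icc (-S₁) S₂, ∀ i, √2 * Y i t ω - Var[Y i t; P] - d i t > w i}

/-- The componentwise product `C B` of a vector `C` and a vector-valued process `B`. -/
def scaledProcess {Ω : Type*} {n : ℕ} (C : Fin n → ℝ) (B : Fin n → ℝ → Ω → ℝ) :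
    Fin n → ℝ → Ω → ℝ :=
  fun i t ω => C i * B i t ω

/-- The drift `dᵢ(t) = dloᵢ |t|^κ 1_{t ≤ 0} + dupᵢ |t|^κ 1_{t > 0}`. -/
def piterbargDrift {n : ℕ} (κ : ℝ) (dlo dup : Fin n → ℝ) : Fin n → ℝ → ℝ :=
  fun i t => if t ≤ 0 then dlo i * |t| ^ κ else dup i * |t| ^ κ

/-- `H_{CB}(S) / S`, where `H_{CB}(S) = H_{CB,0}[0,S]`. -/
def pickandsRatio {Ω : Type*} [MeasurableSpace Ω] (P : Measure Ω) {n : ℕ}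
    (C : Fin n → ℝ) (B : Fin n → ℝ → Ω → ℝ) (S : ℝ) : ℝ≥0∞ :=
  pickandsPiterbargH P (scaledProcess C B) (fun _ _ => 0) 0 S / ENNReal.ofReal S

/-- The generalized Pickands constant `H_{CB} = lim_{S → ∞} H_{CB}(S) / S`. -/
def pickandsConst {Ω : Type*} [MeasurableSpace Ω] (P : Measure Ω) {n : ℕ}
    (C : Fin n → ℝ) (B : Fin n → ℝ → Ω → ℝ) : ℝ≥0∞ :=
  limUnder atTop (pickandsRatio P C B)

/-- `H_{CB,d}[0,S]` for the drift `dᵢ(t) = dupᵢ |t|^κ`, `t ≥ 0` (the values of the drift at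
negative times play no role on the interval `[0,S]`). -/
def piterbargOneSidedH {Ω : Type*} [MeasurableSpace Ω] (P : Measure Ω) {n : ℕ} (κ : ℝ)
    (C : Fin n → ℝ) (B : Fin n → ℝ → Ω → ℝ) (dup : Fin n → ℝ) (S : ℝ) : ℝ≥0∞ :=
  pickandsPiterbargH P (scaledProcess C B) (fun i t => dup i * |t| ^ κ) 0 S

/-- The one-sided generalized Piterbarg constant `lim_{S → ∞} H_{CB,d}[0,S]`. -/
def piterbargOneSided {Ω : Type*} [MeasurableSpace Ω] (P : Measure Ω) {n : ℕ} (κ : ℝ)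
    (C : Fin n → ℝ) (B : Fin n → ℝ → Ω → ℝ) (dup : Fin n → ℝ) : ℝ≥0∞ :=
  limUnder atTop (piterbargOneSidedH P κ C B dup)

/-- `H_{CB,d}[-S,S]` for the two-sided drift `d`. -/
def piterbargTwoSidedH {Ω : Type*} [MeasurableSpace Ω] (P : Measure Ω) {n : ℕ} (κ : ℝ)
    (C : Fin n → ℝ) (B : Fin n → ℝ → Ω → ℝ) (dlo dup : Fin n → ℝ) (S : ℝ) : ℝ≥0∞ :=
  pickandsPiterbargH P (scaledProcess C B) (piterbargDrift κ dlo dup) S S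

/-- The two-sided generalized Piterbarg constant `lim_{S → ∞} H_{CB,d}[-S,S]`. -/
def piterbargTwoSided {Ω : Type*} [MeasurableSpace Ω] (P : Measure Ω) {n : ℕ} (κ : ℝ)
    (C : Fin n → ℝ) (B : Fin n → ℝ → Ω → ℝ) (dlo dup : Fin n → ℝ) : ℝ≥0∞ :=
  limUnder atTop (piterbargTwoSidedH P κ C B dlo dup)

end

/-!
Write `Zᵢ(t) = √2 Cᵢ Bᵢ(t) - Cᵢ² |t|^κ` and `H(D) = ∫ exp(∑ᵢ wᵢ) P(∃ t ∈ D, ∀ i, Zᵢ(t) > wᵢ) dw`.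

The heart of the argument is that `H` is invariant under translations of `D`
(`expExceedance_Icc_add`). Exchanging the integrals, `H(D) = E Φ_D(Z)` with a path functional `Φ_D`
satisfying `Φ_D(x + c) = exp(∑ᵢ cᵢ) Φ_D(x)` for constant vectors `c`, so that
`H(a + D) = E exp(∑ᵢ Zᵢ(a)) Φ_D(Z(a + ·) - Z(a))`. Under the tilted measure `exp(∑ᵢ Zᵢ(a)) dP` the
increments `Z(a + ·) - Z(a)` have the law of `Z` under `P`
(`map_withDensity_wickField_increments`). This is a Cameron-Martin computation: the Laplace
transforms of the finite-dimensional marginals, finite everywhere, agree and determine the laws.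
Sample path continuity reduces intervals to countable dense sets of times, for which everything is
measurable.

Invariance makes `S ↦ H[0,S]` subadditive, and Fekete's lemma in `[0, ∞]` gives
`H_{CB} = lim H[0,S] / S = inf H[0,S] / S`. The Piterbarg quantities are monotone in `S`, so they
converge.

For the lower bounds, let `δ` be the sum of the positive parts in the claim and let `I` be `[0,T]`
or `[-T,T]`. On `I` the drifts are bounded by constants adding up to at most `δ T^κ`, and a constant
drift only costs a factor `exp(-δ T^κ)`, by a translation of `w`. Hence the Piterbarg constant is at
least `exp(-δ T^κ) H(I) ≥ |I| exp(-δ T^κ) H_{CB}`, and `T = (κ δ)^(-1/κ)` maximizes the right-hand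
side.
-/

/-! ### Laplace transforms and Gaussian exponential moments -/

/-- A finite measure whose Laplace transform is finite everywhere is determined by it: by analytic
continuation the Laplace transform determines the characteristic function. -/
theorem MeasureTheory.Measure.ext_of_lintegral_exp_dual {E : Type*} [NormedAddCommGroup E]
    [NormedSpace ℝ E] [CompleteSpace E] [SecondCountableTopology E] [MeasurableSpace E]
    [BorelSpace E] {μ ν : Measure E} [IsFiniteMeasure μ]
    (h : ∀ L : StrongDual ℝ E, ∫⁻ x, ENNReal.ofReal (Real.exp (L x)) ∂μ =
      ∫⁻ x, ENNReal.ofReal (Real.exp (L x)) ∂ν)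
    (hfin : ∀ L : StrongDual ℝ E, ∫⁻ x, ENNReal.ofReal (Real.exp (L x)) ∂μ ≠ ∞) :
    μ = ν := by
  have hmass : μ Set.univ = ν Set.univ := by simpa using h 0
  have : IsFiniteMeasure ν := ⟨by rw [← hmass]; exact measure_lt_top _ _⟩
  refine Measure.ext_of_charFunDual ?_
  ext L
  have hmgf : mgf L μ = mgf L ν := by
    ext s
    have hs := h (s • L)
    simp only [mgf]
    rw [integral_eq_lintegral_of_nonneg_ae (ae_of_all _ fun _ => (Real.exp_pos _).le)
      (by fun_prop), integral_eq_lintegral_of_nonneg_ae (ae_of_all _ fun _ => (Real.exp_pos _).le)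
      (by fun_prop)]
    simpa using congrArg ENNReal.toReal hs
  have hint : integrableExpSet L μ = Set.univ := by
    refine Set.eq_univ_of_forall fun s => ?_
    refine (lintegral_ofReal_ne_top_iff_integrable (by fun_prop)
      (ae_of_all _ fun _ => (Real.exp_pos _).le)).1 ?_
    simpa using hfin (s • L)
  have hzero : μ = 0 ↔ ν = 0 := by
    rw [← Measure.measure_univ_eq_zero, hmass, Measure.measure_univ_eq_zero]
  have key := eqOn_complexMGF_of_mgf' hmgf hzero (x := Complex.I) (by simp [hint])
  simp only [complexMGF] at key
  simp only [charFunDual_apply]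
  simpa [mul_comm] using key

theorem ProbabilityTheory.HasGaussianLaw.lintegral_exp {Ω : Type*} [MeasurableSpace Ω]
    {P : Measure Ω} {X : Ω → ℝ} (hX : HasGaussianLaw X P) (m : ℝ) :
    ∫⁻ ω, ENNReal.ofReal (Real.exp (X ω + m)) ∂P =
      ENNReal.ofReal (Real.exp (∫ ω, X ω ∂P + Var[X; P] / 2 + m)) := by
  have hmgf := mgf_gaussianReal hX.map_eq_gaussianReal 1
  have := hX.isProbabilityMeasure
  have hint : Integrable (fun ω => Real.exp (1 * X ω)) P := by
    rw [← mgf_pos_iff, hmgf]; exact Real.exp_pos _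
  simp only [mgf, one_mul] at hmgf hint
  rw [← ofReal_integral_eq_lintegral_ofReal _ (ae_of_all _ fun _ => (Real.exp_pos _).le)]
  · simp only [Real.exp_add _ m]
    rw [integral_mul_const, hmgf]
    simp [Real.coe_toNNReal _ (variance_nonneg X P)]
  · simp only [Real.exp_add _ m]
    exact hint.mul_const _

/-! ### Exponential tilting of fractional Brownian motion -/

namespace IsStandardFBM

variable {Ω : Type*} [MeasurableSpace Ω] {P : Measure Ω} {κ : ℝ} {X : ℝ → Ω → ℝ}

theorem memLp_two (hX : IsStandardFBM P κ X) (t : ℝ) : MemLp (X t) 2 P :=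
  (hX.gaussian.hasGaussianLaw_eval t).memLp_two

theorem variance_eq (hX : IsStandardFBM P κ X) (hκ : 0 < κ) (t : ℝ) :
    Var[X t; P] = |t| ^ κ := by
  rw [← covariance_self (hX.measurable t).aemeasurable, hX.covariance_eq]
  simp [Real.zero_rpow hκ.ne']

theorem hasGaussianLaw_sum (hX : IsStandardFBM P κ X) (J : Finset ℝ) (c : ℝ → ℝ) :
    HasGaussianLaw (fun ω => ∑ t ∈ J, c t * X t ω) P := by
  simpa using (hX.gaussian.smul c).hasGaussianLaw_fun_sum (I := J)

theorem hasGaussianLaw_add_sum_increments (hX : IsStandardFBM P κ X) (a : ℝ) (J : Finset ℝ)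
    (c : ℝ → ℝ) :
    HasGaussianLaw (fun ω => X a ω + ∑ t ∈ J, c t * (X (a + t) ω - X a ω)) P := by
  classical
  let K : Finset ℝ := insert a (J.image (a + ·))
  let e : K → (K → ℝ) →L[ℝ] ℝ := fun k => ContinuousLinearMap.proj k
  let L : (K → ℝ) →L[ℝ] ℝ := e ⟨a, by simp [K]⟩ +
    ∑ t ∈ J.attach, c t • (e ⟨a + t, by simp [K, t.2]⟩ - e ⟨a, by simp [K]⟩)
  have hL : (fun ω => X a ω + ∑ t ∈ J, c t * (X (a + t) ω - X a ω)) =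
      fun ω => L (K.restrict (X · ω)) := by
    ext ω
    rw [← Finset.sum_attach J]
    simp [L, e]
  rw [hL]
  exact (hX.gaussian.hasGaussianLaw K).map_fun L

theorem covariance_increments (hX : IsStandardFBM P κ X) [IsFiniteMeasure P]
    (hκ : 0 < κ) (a s t : ℝ) :
    cov[X (a + s) - X a, X (a + t) - X a; P] = cov[X s, X t; P] := by
  have hm := hX.memLp_two
  rw [covariance_sub_left (hm _) (hm _) ((hm _).sub (hm _)), covariance_sub_right (hm _) (hm _) (hm _),
    covariance_sub_right (hm _) (hm _) (hm _)]
  simp only [hX.covariance_eq]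
  have h1 : a - (a + s) = -s := by ring
  have h2 : a + t - (a + s) = t - s := by ring
  simp [h1, h2, Real.zero_rpow hκ.ne']
  ring

theorem covariance_increment (hX : IsStandardFBM P κ X) [IsFiniteMeasure P]
    (hκ : 0 < κ) (a t : ℝ) :
    cov[X a, X (a + t) - X a; P] = (|a + t| ^ κ - |t| ^ κ - |a| ^ κ) / 2 := by
  have hm := hX.memLp_two
  rw [covariance_sub_right (hm _) (hm _) (hm _)]
  simp only [hX.covariance_eq]
  simp [Real.zero_rpow hκ.ne']
  ring

theorem variance_sum (hX : IsStandardFBM P κ X) [IsFiniteMeasure P] (J : Finset ℝ) (c : ℝ → ℝ) :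
    Var[fun ω => ∑ t ∈ J, c t * X t ω; P] =
      ∑ s ∈ J, ∑ t ∈ J, c s * c t * cov[X s, X t; P] := by
  have hm : ∀ t ∈ J, MemLp (fun ω => c t * X t ω) 2 P := fun t _ => (hX.memLp_two t).const_mul _
  rw [variance_fun_sum' hm]
  simp only [covariance_const_mul_left, covariance_const_mul_right]
  exact Finset.sum_congr rfl fun s _ => Finset.sum_congr rfl fun t _ => by ring

theorem variance_add_sum_increments (hX : IsStandardFBM P κ X) [IsFiniteMeasure P]
    (hκ : 0 < κ) (a : ℝ) (J : Finset ℝ) (c : ℝ → ℝ) :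
    Var[fun ω => X a ω + ∑ t ∈ J, c t * (X (a + t) ω - X a ω); P] =
      |a| ^ κ + (∑ t ∈ J, c t * (|a + t| ^ κ - |t| ^ κ - |a| ^ κ)) +
        Var[fun ω => ∑ t ∈ J, c t * X t ω; P] := by
  have hm := hX.memLp_two
  have hW : ∀ t, MemLp (X (a + t) - X a) 2 P := fun t => (hm _).sub (hm _)
  have hW' : ∀ t ∈ J, MemLp (fun ω => c t * (X (a + t) - X a) ω) 2 P :=
    fun t _ => (hW t).const_mul _
  rw [hX.variance_sum]
  change Var[fun ω => X a ω + ∑ t ∈ J, c t * (X (a + t) - X a) ω; P] = _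
  rw [variance_fun_add (hm a) (memLp_finsetSum _ hW'), variance_fun_sum' hW',
    covariance_fun_sum_right' hW' (hm a), hX.variance_eq hκ]
  simp only [covariance_const_mul_left, covariance_const_mul_right,
    hX.covariance_increments hκ, hX.covariance_increment hκ, Finset.mul_sum]
  congr 1
  · congr 1
    exact Finset.sum_congr rfl fun t _ => by ring
  · exact Finset.sum_congr rfl fun s _ => Finset.sum_congr rfl fun t _ => by ring

theorem integral_sum_eq_zero (hX : IsStandardFBM P κ X) (J : Finset ℝ) (c : ℝ → ℝ) :
    ∫ ω, ∑ t ∈ J, c t * X t ω ∂P = 0 := by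
  rw [integral_finsetSum _ fun t _ =>
    ((hX.gaussian.hasGaussianLaw_eval t).integrable.const_mul _)]
  simp [integral_const_mul, hX.centered]

theorem integral_add_sum_increments_eq_zero (hX : IsStandardFBM P κ X) (a : ℝ) (J : Finset ℝ)
    (c : ℝ → ℝ) :
    ∫ ω, (X a ω + ∑ t ∈ J, c t * (X (a + t) ω - X a ω)) ∂P = 0 := by
  have hi := fun t => (hX.gaussian.hasGaussianLaw_eval t).integrable
  have hi' : ∀ t ∈ J, Integrable (fun ω => c t * (X (a + t) ω - X a ω)) P :=
    fun t _ => ((hi _).sub (hi _)).const_mul _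
  rw [integral_add (hi a) (integrable_finsetSum _ hi'), integral_finsetSum _ hi']
  simp [integral_const_mul, integral_sub (hi _) (hi _), hX.centered]

end IsStandardFBM

/-- The field `√2 Yᵢ(t) - Var(Yᵢ(t))`, normalized so that its exponential has mean one when `Y` is
centered Gaussian. -/
noncomputable def wickField {Ω : Type*} [MeasurableSpace Ω] (P : Measure Ω) {n : ℕ}
    (Y : Fin n → ℝ → Ω → ℝ) (i : Fin n) (t : ℝ) (ω : Ω) : ℝ :=
  √2 * Y i t ω - Var[Y i t; P]

section

variable {Ω : Type*} [MeasurableSpace Ω] {P : Measure Ω} {n : ℕ} {κ : ℝ} {B : Fin n → ℝ → Ω → ℝ}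
  {C : Fin n → ℝ}

theorem wickField_scaledProcess (hB : ∀ i, IsStandardFBM P κ (B i)) (hκ : 0 < κ) (i : Fin n)
    (t : ℝ) (ω : Ω) :
    wickField P (scaledProcess C B) i t ω = √2 * C i * B i t ω - C i ^ 2 * |t| ^ κ := by
  have : Var[scaledProcess C B i t; P] = C i ^ 2 * |t| ^ κ := by
    rw [← (hB i).variance_eq hκ, ← variance_const_mul]; rfl
  rw [wickField, this, scaledProcess]
  ring

theorem lintegral_exp_sum_wickField [IsFiniteMeasure P] (hB : ∀ i, IsStandardFBM P κ (B i))
    (hκ : 0 < κ) (i : Fin n) (J : Finset ℝ) (c : ℝ → ℝ) :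
    ∫⁻ ω, ENNReal.ofReal (Real.exp (∑ t ∈ J, c t * wickField P (scaledProcess C B) i t ω)) ∂P =
      ENNReal.ofReal (Real.exp (C i ^ 2 * (Var[fun ω => ∑ t ∈ J, c t * B i t ω; P] -
        ∑ t ∈ J, c t * |t| ^ κ))) := by
  have hG := ((hB i).hasGaussianLaw_sum J c).fun_smul (√2 * C i)
  simp only [smul_eq_mul] at hG
  have h := hG.lintegral_exp (-(C i ^ 2 * ∑ t ∈ J, c t * |t| ^ κ))
  rw [integral_const_mul, (hB i).integral_sum_eq_zero, variance_const_mul] at h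
  convert h using 4 with ω
  · simp only [wickField_scaledProcess hB hκ, Finset.mul_sum, ← sub_eq_add_neg]
    rw [← Finset.sum_sub_distrib]
    exact congrArg _ (Finset.sum_congr rfl fun t _ => by ring)
  · rw [mul_pow, Real.sq_sqrt zero_le_two]
    ring

/-- The Cameron-Martin identity for Laplace transforms of finite-dimensional marginals: the
covariances of `Z(a)` with the increments compensate exactly for the change of the centering from
`|a + t|^κ - |a|^κ` to `|t|^κ`. -/
theorem lintegral_exp_add_sum_increments_wickField [IsFiniteMeasure P]
    (hB : ∀ i, IsStandardFBM P κ (B i)) (hκ : 0 < κ) (i : Fin n) (a : ℝ) (J : Finset ℝ)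
    (c : ℝ → ℝ) :
    ∫⁻ ω, ENNReal.ofReal (Real.exp (wickField P (scaledProcess C B) i a ω +
      ∑ t ∈ J, c t * (wickField P (scaledProcess C B) i (a + t) ω -
        wickField P (scaledProcess C B) i a ω))) ∂P =
      ∫⁻ ω, ENNReal.ofReal
        (Real.exp (∑ t ∈ J, c t * wickField P (scaledProcess C B) i t ω)) ∂P := by
  rw [lintegral_exp_sum_wickField hB hκ]
  have hG := ((hB i).hasGaussianLaw_add_sum_increments a J c).fun_smul (√2 * C i)
  simp only [smul_eq_mul] at hG
  have h := hG.lintegral_exp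
    (-(C i ^ 2 * (|a| ^ κ + ∑ t ∈ J, c t * (|a + t| ^ κ - |a| ^ κ))))
  rw [integral_const_mul, (hB i).integral_add_sum_increments_eq_zero, variance_const_mul,
    (hB i).variance_add_sum_increments hκ] at h
  convert h using 4 with ω
  · simp only [wickField_scaledProcess hB hκ, mul_add, Finset.mul_sum]
    rw [add_neg_eq_iff_eq_add.2, ]
    rw [add_add_add_comm, sub_add_cancel, ← Finset.sum_add_distrib]
    congr 1
    exact Finset.sum_congr rfl fun t _ => by ring
  · rw [mul_pow, Real.sq_sqrt zero_le_two]
    have : ∑ t ∈ J, c t * (|a + t| ^ κ - |t| ^ κ - |a| ^ κ) =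
        ∑ t ∈ J, c t * (|a + t| ^ κ - |a| ^ κ) - ∑ t ∈ J, c t * |t| ^ κ := by
      rw [← Finset.sum_sub_distrib]
      exact Finset.sum_congr rfl fun t _ => by ring
    rw [this]
    ring

theorem measurable_wickField (hB : ∀ i, IsStandardFBM P κ (B i)) (i : Fin n) (t : ℝ) :
    Measurable (wickField P (scaledProcess C B) i t) :=
  (((hB i).measurable t).const_mul (C i)).const_mul _ |>.sub_const _

/-- Exponential tilting by `∑ᵢ Zᵢ(a)` turns the increments of the field `Z` from `a` on into a copy
of `Z`. -/
theorem map_withDensity_wickField_increments (hB : IsVectorFBM P κ B) (hκ : 0 < κ) (a : ℝ) :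
    (P.withDensity fun ω =>
        ENNReal.ofReal (Real.exp (∑ i, wickField P (scaledProcess C B) i a ω))).map
      (fun ω (k : Fin n × ℝ) => wickField P (scaledProcess C B) k.1 (a + k.2) ω -
        wickField P (scaledProcess C B) k.1 a ω) =
    P.map fun ω (k : Fin n × ℝ) => wickField P (scaledProcess C B) k.1 k.2 ω := by
  classical
  have := hB.indep.isProbabilityMeasure
  set Z := wickField P (scaledProcess C B) with hZdef
  have hZ : ∀ i t, Measurable (Z i t) := measurable_wickField hB.isStandardFBM
  have hpath : Measurable fun ω (k : Fin n × ℝ) => Z k.1 k.2 ω :=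
    measurable_pi_lambda _ fun k => hZ _ _
  have hincr : Measurable fun ω (k : Fin n × ℝ) => Z k.1 (a + k.2) ω - Z k.1 a ω :=
    measurable_pi_lambda _ fun k => (hZ _ _).sub (hZ _ _)
  have hdens : Measurable fun ω => ENNReal.ofReal (Real.exp (∑ i, Z i a ω)) := by fun_prop
  -- Independence of the coordinates reduces the Laplace transforms to one coordinate at a time.
  have hprod : ∀ f : Fin n → (ℝ → ℝ) → ℝ, (∀ i, Measurable (f i)) →
      ∫⁻ ω, ENNReal.ofReal (Real.exp (∑ i, f i fun t => B i t ω)) ∂P =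
        ∏ i, ∫⁻ ω, ENNReal.ofReal (Real.exp (f i fun t => B i t ω)) ∂P := by
    intro f hf
    have hg : ∀ i, Measurable fun x : ℝ → ℝ => ENNReal.ofReal (Real.exp (f i x)) :=
      fun i => by fun_prop
    rw [← lintegral_prod_eq_prod_lintegral_of_indepFun Finset.univ
      (fun i ω => ENNReal.ofReal (Real.exp (f i fun t => B i t ω)))
      (hB.indep.comp _ hg) fun i => (hg i).comp
        (measurable_pi_lambda _ fun t => (hB.isStandardFBM i).measurable t)]
    refine lintegral_congr fun ω => ?_
    rw [Real.exp_sum, ENNReal.ofReal_prod_of_nonneg fun _ _ => (Real.exp_pos _).le]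
  have hZB : ∀ i t, ∃ g : (ℝ → ℝ) → ℝ, Measurable g ∧ ∀ ω, Z i t ω = g fun s => B i s ω :=
    fun i t => ⟨fun x => √2 * C i * x t - C i ^ 2 * |t| ^ κ,
      by fun_prop, fun ω => wickField_scaledProcess hB.isStandardFBM hκ i t ω⟩
  choose g hg hZg using hZB
  refine IsProjectiveLimit.unique (P := fun I => P.map fun ω => I.restrict
    fun k : Fin n × ℝ => Z k.1 k.2 ω) (fun I => ?_) (fun I => ?_)
  swap
  · rw [Measure.map_map (by fun_prop) hpath]; rfl
  rw [Measure.map_map (by fun_prop) hincr]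
  symm
  have hpI : Measurable fun ω => I.restrict fun k : Fin n × ℝ => Z k.1 k.2 ω :=
    (Finset.measurable_restrict I).comp hpath
  have hiI := (Finset.measurable_restrict I).comp hincr
  have hL : ∀ L : StrongDual ℝ (I → ℝ), ∃ (J : Finset ℝ) (c : Fin n → ℝ → ℝ),
      ∀ x : Fin n × ℝ → ℝ, L (I.restrict x) = ∑ i, ∑ t ∈ J, c i t * x (i, t) := by
    intro L
    -- Extending the coefficients by zero turns the sum over `I` into one over a product.
    let c : Fin n × ℝ → ℝ := fun k => if hk : k ∈ I then L (Pi.single ⟨k, hk⟩ 1) else 0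
    refine ⟨I.image Prod.snd, fun i t => c (i, t), fun x => ?_⟩
    rw [← Finset.sum_product' Finset.univ (I.image Prod.snd)
      (fun i t => c (i, t) * x (i, t))]
    rw [← Finset.sum_subset (s₁ := I), ← Finset.sum_attach]
    · conv_lhs => rw [pi_eq_sum_univ' (I.restrict x)]
      simp only [map_sum, map_smul, smul_eq_mul, Finset.univ_eq_attach]
      refine Finset.sum_congr rfl fun k _ => ?_
      simp only [c, k.2, dif_pos, Finset.restrict, mul_comm]
    · intro k hk
      simp only [Finset.mem_product, Finset.mem_univ, true_and]
      exact Finset.mem_image_of_mem _ hk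
    · intro k _ hk
      simp [c, hk]
  have hmeasL : ∀ L : StrongDual ℝ (I → ℝ),
      Measurable fun x => ENNReal.ofReal (Real.exp (L x)) := fun L => by fun_prop
  have := Measure.isFiniteMeasure_map P (fun ω => I.restrict fun k : Fin n × ℝ => Z k.1 k.2 ω)
  refine Measure.ext_of_lintegral_exp_dual (fun L => ?_) (fun L => ?_) <;>
    obtain ⟨J, c, hc⟩ := hL L
  · rw [lintegral_map (hmeasL L) hpI, lintegral_map (hmeasL L) hiI,
      lintegral_withDensity_eq_lintegral_mul _ hdens
        (g := fun ω => ENNReal.ofReal (Real.exp (L _))) ((hmeasL L).comp hiI)]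
    simp only [hc, Function.comp_apply, Pi.mul_apply]
    have e1 := hprod (fun i x => ∑ t ∈ J, c i t * g i t x) (by fun_prop)
    have e2 := hprod (fun i x => g i a x + ∑ t ∈ J, c i t * (g i (a + t) x - g i a x))
      (by fun_prop)
    simp only [← hZg] at e1 e2
    rw [e1]
    simp only [hZdef, ← lintegral_exp_add_sum_increments_wickField hB.isStandardFBM hκ _ a]
    simp only [← hZdef]
    rw [← e2]
    refine lintegral_congr fun ω => ?_
    rw [← ENNReal.ofReal_mul (Real.exp_pos _).le, ← Real.exp_add, Finset.sum_add_distrib]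
  · rw [lintegral_map (hmeasL L) hpI]
    simp only [hc]
    have e1 := hprod (fun i x => ∑ t ∈ J, c i t * g i t x) (by fun_prop)
    simp only [← hZg] at e1
    rw [e1]
    refine ENNReal.prod_ne_top fun i _ => ?_
    rw [hZdef, lintegral_exp_sum_wickField hB.isStandardFBM hκ]
    exact ENNReal.ofReal_ne_top

end

/-! ### The exceedance functional -/

/-- `∫ exp(∑ᵢ wᵢ) P(∃ t ∈ D, ∀ i, Zᵢ(t) > wᵢ) dw` for a field `Z` and a set `D` of times. -/
noncomputable def expExceedance {Ω : Type*} [MeasurableSpace Ω] (P : Measure Ω) {n : ℕ}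
    (Z : Fin n → ℝ → Ω → ℝ) (D : Set ℝ) : ℝ≥0∞ :=
  ∫⁻ w : Fin n → ℝ, ENNReal.ofReal (Real.exp (∑ i, w i)) * P {ω | ∃ t ∈ D, ∀ i, Z i t ω > w i}

/-- `∫ exp(∑ᵢ wᵢ) 1(∃ t ∈ D, ∀ i, xᵢ(t) > wᵢ) dw` for a single path `x`. -/
noncomputable def pathExceedance {n : ℕ} (D : Set ℝ) (x : Fin n × ℝ → ℝ) : ℝ≥0∞ :=
  ∫⁻ w : Fin n → ℝ, ENNReal.ofReal (Real.exp (∑ i, w i)) *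
    {w : Fin n → ℝ | ∃ t ∈ D, ∀ i, x (i, t) > w i}.indicator 1 w

section

variable {Ω : Type*} [MeasurableSpace Ω] {P : Measure Ω} {n : ℕ} {Z : Fin n → ℝ → Ω → ℝ}

/-- Translating the level by `c` multiplies the weight `exp(∑ᵢ wᵢ)` by `exp(∑ᵢ cᵢ)`. -/
theorem lintegral_exp_sum_mul_add (c : Fin n → ℝ) (f : (Fin n → ℝ) → ℝ≥0∞) :
    ∫⁻ w : Fin n → ℝ, ENNReal.ofReal (Real.exp (∑ i, w i)) * f (w + c) =
      ENNReal.ofReal (Real.exp (-∑ i, c i)) *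
        ∫⁻ w : Fin n → ℝ, ENNReal.ofReal (Real.exp (∑ i, w i)) * f w := by
  rw [← lintegral_const_mul' _ _ ENNReal.ofReal_ne_top,
    ← lintegral_add_right_eq_self (fun w => ENNReal.ofReal (Real.exp (-∑ i, c i)) *
      (ENNReal.ofReal (Real.exp (∑ i, w i)) * f w)) c]
  refine lintegral_congr fun w => ?_
  rw [← mul_assoc, ← ENNReal.ofReal_mul (Real.exp_pos _).le, ← Real.exp_add]
  simp [Finset.sum_add_distrib]

theorem pathExceedance_add (D : Set ℝ) (c : Fin n → ℝ) (x : Fin n × ℝ → ℝ) :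
    pathExceedance D (fun k => x k + c k.1) =
      ENNReal.ofReal (Real.exp (∑ i, c i)) * pathExceedance D x := by
  have h := lintegral_exp_sum_mul_add (-c)
    ({w : Fin n → ℝ | ∃ t ∈ D, ∀ i, x (i, t) > w i}.indicator 1)
  simp only [Pi.neg_apply, Finset.sum_neg_distrib, neg_neg] at h
  rw [pathExceedance, pathExceedance, ← h]
  refine lintegral_congr fun w => ?_
  have hset : {w : Fin n → ℝ | ∃ t ∈ D, ∀ i, x (i, t) + c i > w i} =
      (fun w => w + -c) ⁻¹' {w | ∃ t ∈ D, ∀ i, x (i, t) > w i} := by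
    ext w
    refine exists_congr fun t => and_congr_right fun _ => forall_congr' fun i => ?_
    simp only [Pi.add_apply, Pi.neg_apply, gt_iff_lt]
    exact sub_lt_iff_lt_add.symm
  rw [hset]
  rfl

theorem measurableSet_exceedance {D : Set ℝ} (hD : D.Countable) :
    MeasurableSet {p : (Fin n → ℝ) × (Fin n × ℝ → ℝ) | ∃ t ∈ D, ∀ i, p.2 (i, t) > p.1 i} := by
  have : {p : (Fin n → ℝ) × (Fin n × ℝ → ℝ) | ∃ t ∈ D, ∀ i, p.2 (i, t) > p.1 i} =
      ⋃ t ∈ D, ⋂ i, {p | p.1 i < p.2 (i, t)} := by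
    ext p; simp
  rw [this]
  exact .biUnion hD fun t _ => .iInter fun i => measurableSet_lt (by fun_prop) (by fun_prop)

theorem measurable_pathExceedance {D : Set ℝ} (hD : D.Countable) :
    Measurable (pathExceedance (n := n) D) := by
  have h : Measurable fun p : (Fin n × ℝ → ℝ) × (Fin n → ℝ) =>
      ENNReal.ofReal (Real.exp (∑ i, p.2 i)) *
        {p : (Fin n → ℝ) × (Fin n × ℝ → ℝ) | ∃ t ∈ D, ∀ i, p.2 (i, t) > p.1 i}.indicator 1 p.swap :=
    Measurable.mul (by fun_prop)
      ((measurable_one.indicator (measurableSet_exceedance hD)).comp measurable_swap)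
  exact h.lintegral_prod_right'

theorem measurableSet_prod_exceedance (hZ : ∀ i t, Measurable (Z i t)) {D : Set ℝ}
    (hD : D.Countable) :
    MeasurableSet {p : (Fin n → ℝ) × Ω | ∃ t ∈ D, ∀ i, Z i t p.2 > p.1 i} := by
  have hm : Measurable fun p : (Fin n → ℝ) × Ω => (p.1, fun k : Fin n × ℝ => Z k.1 k.2 p.2) :=
    measurable_fst.prodMk
      (measurable_pi_lambda _ fun k => (hZ _ _).comp measurable_snd)
  exact hm (measurableSet_exceedance hD)

/-- The order of integration in the definition can be exchanged. -/
theorem expExceedance_eq_lintegral [SFinite P] (hZ : ∀ i t, Measurable (Z i t)) {D : Set ℝ}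
    (hD : D.Countable) :
    expExceedance P Z D = ∫⁻ ω, pathExceedance D (fun k => Z k.1 k.2 ω) ∂P := by
  have hS := measurableSet_prod_exceedance hZ hD
  simp only [expExceedance, pathExceedance]
  rw [← lintegral_lintegral_swap]
  · refine lintegral_congr fun w => ?_
    have hw : MeasurableSet {ω | ∃ t ∈ D, ∀ i, Z i t ω > w i} := measurable_prodMk_left hS
    rw [lintegral_const_mul' _ _ ENNReal.ofReal_ne_top, ← lintegral_indicator_one hw]
    rfl
  · exact (Measurable.mul (by fun_prop) (measurable_one.indicator hS)).aemeasurable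

theorem expExceedance_mono {D E : Set ℝ} (h : D ⊆ E) :
    expExceedance P Z D ≤ expExceedance P Z E :=
  lintegral_mono fun _ => by gcongr

theorem expExceedance_union_le_of_countable [SFinite P] (hZ : ∀ i t, Measurable (Z i t))
    {D E : Set ℝ} (hD : D.Countable) :
    expExceedance P Z (D ∪ E) ≤ expExceedance P Z D + expExceedance P Z E := by
  simp only [expExceedance]
  rw [← lintegral_add_left]
  · refine lintegral_mono fun w => ?_
    rw [← mul_add]
    gcongr
    refine (measure_mono ?_).trans (measure_union_le _ _)
    rintro ω ⟨t, ht | ht, h⟩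
    exacts [.inl ⟨t, ht, h⟩, .inr ⟨t, ht, h⟩]
  · exact Measurable.mul (by fun_prop)
      (measurable_measure_prodMk_left (measurableSet_prod_exceedance hZ hD))

/-- For a field with continuous paths only a dense set of times matters, because the exceedance
condition is open. -/
theorem expExceedance_eq_of_subset_closure (hZ : ∀ᵐ ω ∂P, ∀ i, Continuous fun t => Z i t ω)
    {D E : Set ℝ} (hDE : D ⊆ E) (hED : E ⊆ closure D) :
    expExceedance P Z D = expExceedance P Z E := by
  refine lintegral_congr fun w => ?_
  congr 1
  refine measure_congr ?_
  filter_upwards [hZ] with ω hω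
  refine propext ⟨fun ⟨t, ht, h⟩ => ⟨t, hDE ht, h⟩, fun ⟨t, ht, h⟩ => ?_⟩
  have hopen : IsOpen {s | ∀ i, w i < Z i s ω} := by
    simp only [Set.ofPred_forall]
    exact isOpen_iInter_of_finite fun i => isOpen_lt continuous_const (hω i)
  obtain ⟨s, hs, hsD⟩ := mem_closure_iff.1 (hED ht) _ hopen h
  exact ⟨s, hsD, hs⟩

theorem exists_countable_dense_Icc (b c : ℝ) :
    ∃ D : Set ℝ, D.Countable ∧ D ⊆ Set.Icc b c ∧ Set.Icc b c ⊆ closure D := by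
  obtain ⟨D, h1, h2, h3⟩ := TopologicalSpace.IsSeparable.exists_countable_dense_subset
    (TopologicalSpace.IsSeparable.of_separableSpace (Set.Icc b c))
  exact ⟨D, h2, h1, h3⟩

/-! ### Stationarity and subadditivity -/

variable {κ : ℝ} {B : Fin n → ℝ → Ω → ℝ} {C : Fin n → ℝ}

theorem continuous_wickField_ae (hB : IsVectorFBM P κ B) (hκ : 0 < κ) :
    ∀ᵐ ω ∂P, ∀ i, Continuous fun t => wickField P (scaledProcess C B) i t ω := by
  rw [ae_all_iff]
  intro i
  filter_upwards [(hB.isStandardFBM i).continuous_paths] with ω hω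
  simp only [wickField_scaledProcess hB.isStandardFBM hκ]
  exact (hω.const_mul _).sub
    ((continuous_abs.rpow_const fun _ => .inr hκ.le).const_mul _)

/-- Stationarity over countable sets of times: the path functional is multiplicative under
translations of the level, so that the factor `exp(∑ᵢ Zᵢ(a))` it produces is a change of measure. -/
theorem expExceedance_image_add_of_countable (hB : IsVectorFBM P κ B) (hκ : 0 < κ) (a : ℝ)
    {D : Set ℝ} (hD : D.Countable) :
    expExceedance P (wickField P (scaledProcess C B)) ((a + ·) '' D) =
      expExceedance P (wickField P (scaledProcess C B)) D := by
  have := hB.indep.isProbabilityMeasure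
  have hlaw := map_withDensity_wickField_increments (C := C) hB hκ a
  have hZ : ∀ i t, Measurable (wickField P (scaledProcess C B) i t) :=
    measurable_wickField hB.isStandardFBM
  generalize wickField P (scaledProcess C B) = Z at *
  have hpath : Measurable fun ω (k : Fin n × ℝ) => Z k.1 k.2 ω :=
    measurable_pi_lambda _ fun k => hZ _ _
  have hincr : Measurable fun ω (k : Fin n × ℝ) => Z k.1 (a + k.2) ω - Z k.1 a ω :=
    measurable_pi_lambda _ fun k => (hZ _ _).sub (hZ _ _)
  have hdens : Measurable fun ω => ENNReal.ofReal (Real.exp (∑ i, Z i a ω)) := by fun_prop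
  have hΦ := measurable_pathExceedance (n := n) hD
  rw [expExceedance_eq_lintegral hZ hD, ← lintegral_map hΦ hpath, ← hlaw,
    lintegral_map hΦ hincr, lintegral_withDensity_eq_lintegral_mul _ hdens
      (g := fun ω => pathExceedance D _) (hΦ.comp hincr),
    expExceedance_eq_lintegral hZ (hD.image _)]
  refine lintegral_congr fun ω => ?_
  rw [Pi.mul_apply, ← pathExceedance_add D (fun i => Z i a ω)]
  simp only [pathExceedance, Set.exists_mem_image, sub_add_cancel]

theorem expExceedance_Icc_add (hB : IsVectorFBM P κ B) (hκ : 0 < κ) (a b c : ℝ) :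
    expExceedance P (wickField P (scaledProcess C B)) (Set.Icc (a + b) (a + c)) =
      expExceedance P (wickField P (scaledProcess C B)) (Set.Icc b c) := by
  obtain ⟨D, hDc, hD1, hD2⟩ := exists_countable_dense_Icc b c
  have hcont := continuous_wickField_ae (C := C) hB hκ
  rw [← expExceedance_eq_of_subset_closure hcont hD1 hD2,
    ← expExceedance_image_add_of_countable hB hκ a hDc]
  have himg : (a + ·) '' Set.Icc b c = Set.Icc (a + b) (a + c) := Set.image_const_add_Icc a b c
  symm
  refine expExceedance_eq_of_subset_closure hcont ?_ ?_
  · rw [← himg]; exact Set.image_mono hD1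
  · rw [← himg]
    exact (Set.image_mono hD2).trans
      (image_closure_subset_closure_image (continuous_const_add a))

/-- Subadditivity in the length of the interval. -/
theorem expExceedance_Icc_add_le (hB : IsVectorFBM P κ B) (hκ : 0 < κ) {s t : ℝ} (hs : 0 ≤ s)
    (ht : 0 ≤ t) :
    expExceedance P (wickField P (scaledProcess C B)) (Set.Icc 0 (s + t)) ≤
      expExceedance P (wickField P (scaledProcess C B)) (Set.Icc 0 s) +
        expExceedance P (wickField P (scaledProcess C B)) (Set.Icc 0 t) := by
  have := hB.indep.isProbabilityMeasure
  obtain ⟨D, hDc, hD1, hD2⟩ := exists_countable_dense_Icc 0 s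
  have hcont := continuous_wickField_ae (C := C) hB hκ
  rw [← expExceedance_Icc_add hB hκ s 0 t, add_zero,
    ← Set.Icc_union_Icc_eq_Icc hs (le_add_of_nonneg_right ht),
    ← expExceedance_eq_of_subset_closure hcont hD1 hD2,
    ← expExceedance_eq_of_subset_closure hcont (Set.union_subset_union_left _ hD1)
      (Set.union_subset (hD2.trans (closure_mono Set.subset_union_left))
        (Set.subset_union_right.trans subset_closure))]
  exact expExceedance_union_le_of_countable (measurable_wickField hB.isStandardFBM) hDc

end

/-! ### Fekete's lemma -/

/-- Fekete's lemma for a monotone subadditive function with values in `[0, ∞]`. -/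
theorem tendsto_div_of_monotoneOn_of_subadditive {H : ℝ → ℝ≥0∞}
    (hmono : MonotoneOn H (Set.Ici 0))
    (hsub : ∀ s t, 0 ≤ s → 0 ≤ t → H (s + t) ≤ H s + H t) :
    Tendsto (fun S => H S / ENNReal.ofReal S) atTop
      (𝓝 (⨅ T : Set.Ioi (0 : ℝ), H T / ENNReal.ofReal T)) := by
  refine tendsto_order.2 ⟨fun l hl => ?_, fun u hu => ?_⟩
  · filter_upwards [eventually_gt_atTop 0] with S hS
    exact hl.trans_le (iInf_le (fun T : Set.Ioi (0 : ℝ) => H T / ENNReal.ofReal T) ⟨S, hS⟩)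
  obtain ⟨⟨T, hT⟩, hTu⟩ := iInf_lt_iff.1 hu
  have hT : 0 < T := hT
  change H T / ENNReal.ofReal T < u at hTu
  -- `H T = ∞` is impossible for this `T`, although `H` may take the value `∞` elsewhere.
  have hTfin : H T ≠ ∞ := by
    rintro h
    rw [h, ENNReal.top_div_of_ne_top ENNReal.ofReal_ne_top] at hTu
    exact not_top_lt hTu
  have hmul : ∀ k : ℕ, H ((k + 1) * T) ≤ (k + 1) * H T := by
    intro k
    induction k with
    | zero => simp
    | succ k ih =>
      have := hsub ((k + 1) * T) T (by positivity) hT.le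
      push_cast
      rw [add_mul (k + 1 : ℝ) 1 T, one_mul, add_mul (k + 1 : ℝ≥0∞) 1, one_mul]
      exact this.trans (by gcongr)
  have hbound : ∀ S, 0 < S →
      H S / ENNReal.ofReal S ≤ H T * ENNReal.ofReal (1 / T + 1 / S) := by
    intro S hS
    have hk : S ≤ (⌊S / T⌋₊ + 1 : ℝ) * T := by
      rw [← div_le_iff₀ hT]; exact (Nat.lt_floor_add_one _).le
    have h1 : H S ≤ (⌊S / T⌋₊ + 1 : ℝ≥0∞) * H T :=
      (hmono hS.le (hS.le.trans hk) hk).trans (hmul _)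
    have h2 : (⌊S / T⌋₊ + 1 : ℝ≥0∞) ≤ ENNReal.ofReal (S / T + 1) := by
      rw [ENNReal.ofReal_add (by positivity) zero_le_one, ENNReal.ofReal_one,
        ← ENNReal.ofReal_natCast]
      gcongr
      exact Nat.floor_le (by positivity)
    rw [div_eq_mul_inv, ← ENNReal.ofReal_inv_of_pos hS]
    calc H S * ENNReal.ofReal S⁻¹ ≤ (ENNReal.ofReal (S / T + 1) * H T) * ENNReal.ofReal S⁻¹ := by
          gcongr; exact h1.trans (by gcongr)
      _ = H T * ENNReal.ofReal (1 / T + 1 / S) := by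
          rw [mul_comm (ENNReal.ofReal _), mul_assoc, ← ENNReal.ofReal_mul (by positivity)]
          congr 2
          field_simp
  have hlim : Tendsto (fun S : ℝ => H T * ENNReal.ofReal (1 / T + 1 / S)) atTop
      (𝓝 (H T / ENNReal.ofReal T)) := by
    rw [div_eq_mul_inv (H T), ← ENNReal.ofReal_inv_of_pos hT]
    refine ENNReal.Tendsto.const_mul (ENNReal.tendsto_ofReal ?_) (.inr hTfin)
    simpa using (tendsto_inv_atTop_zero (𝕜 := ℝ)).const_add T⁻¹
  filter_upwards [hlim.eventually_lt_const hTu, eventually_gt_atTop 0] with S h1 hS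
  exact (hbound S hS).trans_lt h1

/-! ### Pickands and Piterbarg constants -/

section

variable {Ω : Type*} [MeasurableSpace Ω] {P : Measure Ω} {n : ℕ}

theorem pickandsPiterbargH_zero (Y : Fin n → ℝ → Ω → ℝ) (S₁ S₂ : ℝ) :
    pickandsPiterbargH P Y (fun _ _ => 0) S₁ S₂ =
      expExceedance P (wickField P Y) (Set.Icc (-S₁) S₂) := by
  simp only [pickandsPiterbargH, expExceedance, wickField, sub_zero]

theorem pickandsPiterbargH_mono (Y : Fin n → ℝ → Ω → ℝ) (d : Fin n → ℝ → ℝ) {S₁ S₂ T₁ T₂ : ℝ}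
    (h₁ : S₁ ≤ T₁) (h₂ : S₂ ≤ T₂) :
    pickandsPiterbargH P Y d S₁ S₂ ≤ pickandsPiterbargH P Y d T₁ T₂ :=
  lintegral_mono fun _ => mul_le_mul_right (measure_mono <| by
    rintro ω ⟨t, ht, h⟩
    exact ⟨t, Set.Icc_subset_Icc (neg_le_neg h₁) h₂ ht, h⟩) _

/-- Replacing the drift by a constant upper bound costs the factor `exp(-∑ᵢ cᵢ)`. -/
theorem le_pickandsPiterbargH_of_drift_le (Y : Fin n → ℝ → Ω → ℝ) {d : Fin n → ℝ → ℝ}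
    {c : Fin n → ℝ} {S₁ S₂ : ℝ} (hd : ∀ t ∈ Set.Icc (-S₁) S₂, ∀ i, d i t ≤ c i) :
    ENNReal.ofReal (Real.exp (-∑ i, c i)) *
      expExceedance P (wickField P Y) (Set.Icc (-S₁) S₂) ≤ pickandsPiterbargH P Y d S₁ S₂ := by
  rw [expExceedance, ← lintegral_exp_sum_mul_add]
  refine lintegral_mono fun w => mul_le_mul_right (measure_mono ?_) _
  rintro ω ⟨t, ht, h⟩
  refine ⟨t, ht, fun i => ?_⟩
  have h1 := hd t ht i
  have h2 := h i
  simp only [wickField, Pi.add_apply] at h2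
  linarith

variable {κ : ℝ} {B : Fin n → ℝ → Ω → ℝ} {C : Fin n → ℝ}

theorem tendsto_pickandsRatio (hB : IsVectorFBM P κ B) (hκ : 0 < κ) :
    Tendsto (pickandsRatio P C B) atTop (𝓝 (⨅ T : Set.Ioi (0 : ℝ), pickandsRatio P C B T)) := by
  have h : ∀ S, pickandsRatio P C B S =
      expExceedance P (wickField P (scaledProcess C B)) (Set.Icc 0 S) / ENNReal.ofReal S := by
    intro S
    rw [pickandsRatio, pickandsPiterbargH_zero, neg_zero]
  rw [funext h]
  exact tendsto_div_of_monotoneOn_of_subadditive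
    (H := fun S => expExceedance P (wickField P (scaledProcess C B)) (Set.Icc 0 S))
    (fun _ _ _ _ hst => expExceedance_mono (Set.Icc_subset_Icc_right hst))
    fun s t hs ht => expExceedance_Icc_add_le hB hκ hs ht

theorem ofReal_mul_pickandsConst_le (hB : IsVectorFBM P κ B) (hκ : 0 < κ) {T : ℝ} (hT : 0 < T)
    (a : ℝ) :
    ENNReal.ofReal T * pickandsConst P C B ≤
      expExceedance P (wickField P (scaledProcess C B)) (Set.Icc a (a + T)) := by
  have h := expExceedance_Icc_add (C := C) hB hκ a 0 T
  rw [add_zero] at h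
  rw [h, mul_comm, pickandsConst, (tendsto_pickandsRatio hB hκ).limUnder_eq]
  refine ENNReal.mul_le_of_le_div
    ((iInf_le (fun T : Set.Ioi (0 : ℝ) => pickandsRatio P C B T) ⟨T, hT⟩).trans_eq ?_)
  change pickandsRatio P C B T = _
  rw [pickandsRatio, pickandsPiterbargH_zero, neg_zero]

theorem tendsto_limUnder_of_monotone {f : ℝ → ℝ≥0∞} (hf : Monotone f) :
    Tendsto f atTop (𝓝 (limUnder atTop f)) :=
  tendsto_nhds_limUnder ⟨_, tendsto_atTop_iSup hf⟩

/-- The maximal value of `T ↦ T exp(-D T^κ)`, attained at `T = (κ D)^(-1/κ)`. -/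
theorem rpow_mul_exp_neg_mul_rpow {D : ℝ} (hκ : 0 < κ) (hD : 0 < D) :
    (κ * D) ^ (-(1 / κ)) * Real.exp (-(D * ((κ * D) ^ (-(1 / κ))) ^ κ)) =
      (Real.exp 1 * κ * D) ^ (-(1 / κ)) := by
  have hκD : 0 < κ * D := mul_pos hκ hD
  rw [← Real.rpow_mul hκD.le, show -(1 / κ) * κ = -1 by field_simp, Real.rpow_neg_one,
    show D * (κ * D)⁻¹ = 1 / κ by field_simp, mul_assoc (Real.exp 1),
    Real.mul_rpow (Real.exp_pos _).le hκD.le, Real.exp_one_rpow, mul_comm]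

/-- If on `[-S₁,S₂]` the drifts are at most `cᵢ R^κ`, they cost at most the factor
`exp(-(∑ᵢ cᵢ) R^κ)` compared with the driftless quantity, which is at least `S₁ + S₂` times the
Pickands constant. -/
theorem ofReal_mul_pickandsConst_le_pickandsPiterbargH (hB : IsVectorFBM P κ B) (hκ : 0 < κ)
    {d : Fin n → ℝ → ℝ} {c : Fin n → ℝ} {R S₁ S₂ : ℝ} (hS : 0 < S₁ + S₂)
    (hd : ∀ t ∈ Set.Icc (-S₁) S₂, ∀ i, d i t ≤ c i * R ^ κ) :
    ENNReal.ofReal ((S₁ + S₂) * Real.exp (-((∑ i, c i) * R ^ κ))) * pickandsConst P C B ≤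
      pickandsPiterbargH P (scaledProcess C B) d S₁ S₂ := by
  refine le_trans ?_ (le_pickandsPiterbargH_of_drift_le _ hd)
  have h := ofReal_mul_pickandsConst_le (C := C) hB hκ hS (-S₁)
  rw [neg_add_cancel_left] at h
  rw [mul_comm (S₁ + S₂), ENNReal.ofReal_mul (Real.exp_pos _).le, mul_assoc, ← Finset.sum_mul]
  gcongr

theorem mul_abs_rpow_le {x y t R : ℝ} (hκ : 0 < κ) (hxy : max 0 x ≤ y) (ht : |t| ≤ R) :
    x * |t| ^ κ ≤ y * R ^ κ := by
  have h1 : |t| ^ κ ≤ R ^ κ := Real.rpow_le_rpow (abs_nonneg t) ht hκ.le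
  exact mul_le_mul ((le_max_right 0 x).trans hxy) h1 (by positivity) ((le_max_left 0 x).trans hxy)

end

/-- Lower bounds for the generalized Piterbarg constants. The first three conjuncts say that
the limits defining the constants exist; the last two are the lower bounds. -/
theorem proposition3p4 {Ω : Type*} [MeasurableSpace Ω] (P : Measure Ω) [IsProbabilityMeasure P]
    {n : ℕ} (κ : ℝ) (hκ_pos : 0 < κ) (hκ_le : κ ≤ 2)
    (B : Fin n → ℝ → Ω → ℝ) (hB : IsVectorFBM P κ B)
    (C : Fin n → ℝ) (hC_nonneg : ∀ i, 0 ≤ C i) (hC_ne : C ≠ 0)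
    (dlo dup : Fin n → ℝ) (hdlo : 0 < ∑ i, dlo i) (hdup : 0 < ∑ i, dup i) :
    Tendsto (pickandsRatio P C B) atTop (𝓝 (pickandsConst P C B)) ∧
    Tendsto (piterbargOneSidedH P κ C B dup) atTop (𝓝 (piterbargOneSided P κ C B dup)) ∧
    Tendsto (piterbargTwoSidedH P κ C B dlo dup) atTop
      (𝓝 (piterbargTwoSided P κ C B dlo dup)) ∧
    piterbargOneSided P κ C B dup ≥
      ENNReal.ofReal ((Real.exp 1 * κ * ∑ i, max 0 (dup i)) ^ (-(1 / κ))) *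
        pickandsConst P C B ∧
    piterbargTwoSided P κ C B dlo dup ≥
      ENNReal.ofReal (2 * (Real.exp 1 * κ) ^ (-(1 / κ)) *
        (∑ i, (max 0 (dlo i) + max 0 (dup i))) ^ (-(1 / κ))) *
        pickandsConst P C B := by
  have hmono₁ : Monotone (piterbargOneSidedH P κ C B dup) := fun _ _ h =>
    pickandsPiterbargH_mono _ _ le_rfl h
  have hmono₂ : Monotone (piterbargTwoSidedH P κ C B dlo dup) := fun _ _ h =>
    pickandsPiterbargH_mono _ _ h h
  have hlim₁ := tendsto_limUnder_of_monotone hmono₁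
  have hlim₂ := tendsto_limUnder_of_monotone hmono₂
  refine ⟨tendsto_nhds_limUnder ⟨_, tendsto_pickandsRatio hB hκ_pos⟩, hlim₁, hlim₂, ?_, ?_⟩
  · have hD : 0 < ∑ i, max 0 (dup i) :=
      hdup.trans_le (Finset.sum_le_sum fun i _ => le_max_right _ _)
    set T := (κ * ∑ i, max 0 (dup i)) ^ (-(1 / κ)) with hT
    have hTpos : 0 < T := by positivity
    refine le_trans ?_ (hmono₁.ge_of_tendsto hlim₁ T)
    rw [← rpow_mul_exp_neg_mul_rpow hκ_pos hD, ← hT]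
    have key := ofReal_mul_pickandsConst_le_pickandsPiterbargH (C := C) hB hκ_pos
      (d := fun i t => dup i * |t| ^ κ) (c := fun i => max 0 (dup i)) (R := T) (S₁ := 0) (S₂ := T)
      (by simpa) fun t ht i => ?_
    · rwa [zero_add] at key
    refine mul_abs_rpow_le hκ_pos le_rfl (abs_le.2 ?_)
    simp only [Set.mem_Icc, neg_zero] at ht
    exact ⟨by linarith, ht.2⟩
  · have hD : 0 < ∑ i, (max 0 (dlo i) + max 0 (dup i)) :=
      hdup.trans_le (Finset.sum_le_sum fun i _ =>
        (le_max_right 0 _).trans (le_add_of_nonneg_left (le_max_left _ _)))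
    set T := (κ * ∑ i, (max 0 (dlo i) + max 0 (dup i))) ^ (-(1 / κ)) with hT
    have hTpos : 0 < T := by positivity
    refine le_trans ?_ (hmono₂.ge_of_tendsto hlim₂ T)
    rw [mul_assoc, ← Real.mul_rpow (by positivity) hD.le, ← rpow_mul_exp_neg_mul_rpow hκ_pos hD,
      ← hT, ← mul_assoc, two_mul]
    refine ofReal_mul_pickandsConst_le_pickandsPiterbargH hB hκ_pos (by linarith) fun t ht i => ?_
    rw [piterbargDrift]
    split_ifs
    · exact mul_abs_rpow_le hκ_pos (le_add_of_nonneg_right (le_max_left _ _)) (abs_le.2 ht)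
    · exact mul_abs_rpow_le hκ_pos (le_add_of_nonneg_left (le_max_left _ _)) (abs_le.2 ht)
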